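/- Let $E$ be a real Fréchet space whose topology is defined by seminorms $\{\|\cdot\|_n\}_{n\in\mathbb N}$, and let $\{e_k\}_{k\in\mathbb N}$ be an unconditional Schauder basis of $E$: every $x\in E$ has a unique expansion $x=\sum_{k=1}^\infty x_ke_k$, and for every permutation $\pi$ of $\mathbb N$ the series $\sum_{k=1}^\infty x_{\pi(k)}e_{\pi(k)}$ converges. For $x,y\in E$ write $x\prec y$ iff $x_k\le y_k$ for all $k$, and let $\mathcal X_k[y]x=x+(y_k-x_k)e_k$ be the element obtained from $x$ by replacing its $k$-th coordinate with that of $y$. Let $0<T<\infty$ and $I_T=[0,T]$. Let $X(t)=\sum_{k=1}^\infty X_k(t)e_k\in C(I_T,E)$ with $X_k\in C^1(I_T)$ and $X_k(t)>0$ for all $k\in\mathbb N$, $t\in I_T$. Put $$W_X^+=\{(t,x)\in I_T\times E\mid 0\prec x\prec X(t)\},$$ and let $f(t,x)=\sum_{k=1}^\infty f_k(t,x)e_k$ belong to $C(W_X^+,E)$. Suppose that for every $(t,x)\in W_X^+$ and every $k\in\mathbb N$ $$f_k(t,\mathcal X_k[X(t)]x)\le\dot X_k(t),\qquad f_k(t,\mathcal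 X_k[0]x)\ge 0,$$ and let $\hat x\in E$ satisfy $0\prec\hat x\prec X(0)$. Then the problem $\dot x=f(t,x)$, $x(0)=\hat x$ has a solution $x(t)\in C^1(I_T,E)$ such that $0\prec x(t)\prec X(t)$ for all $t\in I_T$. Here $x(t)\in C^1(I_T,E)$ means that for each $t\in I_T$ there is $\dot x(t)\in E$ with $\lim_{h\to0}\big\|\frac{x(t+h)-x(t)}{h}-\dot x(t)\big\|_i=0$ for all $i$ (one-sided limits at $t=0$ and $t=T$), and $\dot x\in C(I_T,E)$. -/

import Mathlib

open Set Filter Topology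

namespace CountableODE

section Basis

variable {E : Type*} [AddCommGroup E] [Module ℝ E] [TopologicalSpace E]

/-- `e` is a Schauder basis of `E`: every vector has a unique sequence of scalars `c` such that
the partial sums of `∑ k, c k • e k` converge to it. -/
def IsSchauderBasis (e : ℕ → E) : Prop :=
  ∀ x : E, ∃! c : ℕ → ℝ, Tendsto (fun n => ∑ k ∈ Finset.range n, c k • e k) atTop (𝓝 x)

/-- The `k`-th coordinate of `x` in the Schauder basis `e`. No continuity of the coordinates is
built into the definition. -/
noncomputable def coord {e : ℕ → E} (he : IsSchauderBasis e) (k : ℕ) (x : E) : ℝ :=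
  Classical.choose (he x) k

/-- A Schauder basis is unconditional if every rearrangement of the expansion of every vector
converges. -/
def IsUnconditional {e : ℕ → E} (he : IsSchauderBasis e) : Prop :=
  ∀ (x : E) (π : Equiv.Perm ℕ), ∃ s : E,
    Tendsto (fun n => ∑ k ∈ Finset.range n, coord he (π k) x • e (π k)) atTop (𝓝 s)

/-- The coordinatewise order: `x ≺ y` iff `x_k ≤ y_k` for all `k`. -/
def Prec {e : ℕ → E} (he : IsSchauderBasis e) (x y : E) : Prop :=
  ∀ k, coord he k x ≤ coord he k y

/-- The affine map `x ↦ 𝒳_k[y] x`, which replaces the `k`-th coordinate of `x` by that of `y` and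
keeps all the others (see `coord_replaceCoord`). -/
noncomputable def replaceCoord {e : ℕ → E} (he : IsSchauderBasis e) (k : ℕ) (y x : E) : E :=
  x + (coord he k y - coord he k x) • e k

/-- The set `W_X⁺` of all `(t, x)` with `t ∈ [0, T]` and `0 ≺ x ≺ X(t)`. -/
def WPlus {e : ℕ → E} (he : IsSchauderBasis e) (T : ℝ) (X : ℝ → E) : Set (ℝ × E) :=
  {q | q.1 ∈ Icc 0 T ∧ Prec he 0 q.2 ∧ Prec he q.2 (X q.1)}

theorem tendsto_coord {e : ℕ → E} (he : IsSchauderBasis e) (x : E) :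
    Tendsto (fun n => ∑ k ∈ Finset.range n, coord he k x • e k) atTop (𝓝 x) :=
  (Classical.choose_spec (he x)).1

theorem coord_eq_of_tendsto {e : ℕ → E} (he : IsSchauderBasis e) {x : E} {c : ℕ → ℝ}
    (hc : Tendsto (fun n => ∑ k ∈ Finset.range n, c k • e k) atTop (𝓝 x)) (k : ℕ) :
    coord he k x = c k :=
  (congrFun ((Classical.choose_spec (he x)).2 c hc) k).symm

theorem coord_replaceCoord [ContinuousAdd E] {e : ℕ → E} (he : IsSchauderBasis e)
    (k j : ℕ) (y x : E) :
    coord he j (replaceCoord he k y x) = if j = k then coord he k y else coord he j x := by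
  refine coord_eq_of_tendsto he (c := fun j => if j = k then coord he k y else coord he j x) ?_ j
  refine ((tendsto_coord he x).add_const ((coord he k y - coord he k x) • e k)).congr' ?_
  filter_upwards [eventually_gt_atTop k] with n hn
  have h : (coord he k y - coord he k x) • e k =
      ∑ i ∈ Finset.range n, if i = k then (coord he k y - coord he k x) • e k else 0 := by
    rw [Finset.sum_ite_eq' (Finset.range n) k (fun _ => (coord he k y - coord he k x) • e k),
      if_pos (Finset.mem_range.2 hn)]
  rw [h, ← Finset.sum_add_distrib]
  refine Finset.sum_congr rfl fun i _ => ?_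
  by_cases hi : i = k
  · subst hi
    simp only [if_true, ← add_smul, add_sub_cancel]
  · simp [hi]

theorem coord_zero {e : ℕ → E} (he : IsSchauderBasis e) (k : ℕ) : coord he k (0 : E) = 0 := by
  refine coord_eq_of_tendsto he (c := fun _ => 0) ?_ k
  simpa using tendsto_const_nhds

end Basis

/-- `v` is the derivative at `t` of `x : [0, T] → E` with respect to the seminorms `p i`
(one-sided at the end points of `[0, T]`). -/
def HasSeminormDerivAt {E : Type*} [AddCommGroup E] [Module ℝ E] (p : ℕ → Seminorm ℝ E) (T : ℝ)
    (x : ℝ → E) (v : E) (t : ℝ) : Prop :=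
  ∀ i, Tendsto (fun h : ℝ => p i (h⁻¹ • (x (t + h) - x t) - v))
    (𝓝[{h | h ≠ 0 ∧ t + h ∈ Icc 0 T}] 0) (𝓝 0)

end CountableODE

namespace CountableODE

set_option linter.unusedSectionVars false

/-! Truncate the `k`-th coordinate to `[0, X_k(t)]` for every `k`. The truncated system makes sense
for all real sequences, and each component of its right-hand side is bounded because it factors
through a compact box. Peano's theorem for countable systems (`exists_integral_solution`) then gives
a solution in `ℝ^ℕ`. Where a coordinate of this solution is negative or exceeds `X_k`, the truncated
point lies on the corresponding face of the order interval, and the hypothesis on `f_k` there gives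
its derivative the right sign. By `nonpos_of_hasDerivWithinAt_nonpos` the solution never leaves the
interval, so the truncation is inactive.

What remains is the passage between coordinates and `E`. Unconditional convergence makes all finite
sums far out in an expansion small. Hence, for a continuous seminorm `q`, the supremum of `q` over
all finite subsums of the expansion is finite; a closed graph argument shows that it is again a
continuous seminorm (`IsUnconditional.continuous_supSeminorm`). It follows that the coordinates are
continuous and that the tails are uniformly small on compact sets. Since multipliers in `[0, 1]` do
not enlarge finite subsums, truncated series converge and depend continuously on the data
(`IsUnconditional.continuous_tsum`). The same seminorms turn coordinatewise derivatives into a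
derivative in `E` (`IsUnconditional.hasSeminormDerivAt`). -/

/-! ### Permutations acting on blocks of integers -/

theorem exists_perm_Ico_map_eq (n b : ℕ) (F : Finset ℕ) (hF : ∀ k ∈ F, n ≤ k ∧ k < b) :
    ∃ σ : Equiv.Perm ℕ, (∀ k, σ k ∈ Ico n b ↔ k ∈ Ico n b) ∧
      (Finset.Ico n (n + F.card)).map σ.toEmbedding = F := by
  classical
  have hsub : F ⊆ Finset.Ico n b := fun k hk => Finset.mem_Ico.2 (hF k hk)
  have hcard : F.card ≤ b - n := by simpa using Finset.card_le_card hsub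
  have hlt : ∀ k ∈ Finset.Ico n (n + F.card), k ∈ Finset.Ico n b := by
    intro k hk
    simp only [Finset.mem_Ico] at hk ⊢
    omega
  let e₁ : {x : {x // x ∈ Finset.Ico n b} // x.1 ∈ Finset.Ico n (n + F.card)} ≃
      {x // x ∈ Finset.Ico n (n + F.card)} := Equiv.subtypeSubtypeEquivSubtype (fun {x} hx => hlt x hx)
  let e₂ : {x : {x // x ∈ Finset.Ico n b} // x.1 ∈ F} ≃ {x // x ∈ F} :=
    Equiv.subtypeSubtypeEquivSubtype (fun {x} hx => hsub hx)
  -- Two subsets of the block with equal cardinality: a bijection between them extends to a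
  -- permutation of the block, and then by the identity to `ℕ`.
  let e₃ : {x // x ∈ Finset.Ico n (n + F.card)} ≃ {x // x ∈ F} :=
    Finset.equivOfCardEq (by simp)
  let g := (e₁.trans e₃).trans e₂.symm
  let σ : Equiv.Perm ℕ := Equiv.Perm.ofSubtype g.extendSubtype
  have hσ : ∀ k (hk : k ∈ Finset.Ico n b), σ k = (g.extendSubtype ⟨k, hk⟩).1 := fun k hk =>
    Equiv.Perm.ofSubtype_apply_of_mem _ hk
  refine ⟨σ, fun k => ?_, ?_⟩
  · rw [← Finset.coe_Ico, Finset.mem_coe, Finset.mem_coe]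
    by_cases hk : k ∈ Finset.Ico n b
    · rw [hσ k hk]
      exact iff_of_true (Subtype.prop _) hk
    · rw [show σ k = k from Equiv.Perm.ofSubtype_apply_of_not_mem _ hk]
  · refine Finset.eq_of_subset_of_card_le (fun j hj => ?_) (by simp)
    obtain ⟨k, hk, rfl⟩ := Finset.mem_map.1 hj
    change σ k ∈ F
    rw [hσ k (hlt k hk)]
    exact g.extendSubtype_mem ⟨k, hlt k hk⟩ hk

/-- Permutations of the blocks `[a j, a (j + 1))` glue to a permutation of `ℕ`. -/
theorem exists_perm_eqOn_blocks {a : ℕ → ℕ} (ha : StrictMono a) (ha0 : a 0 = 0)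
    (σ : ℕ → Equiv.Perm ℕ)
    (hσ : ∀ j k, σ j k ∈ Ico (a j) (a (j + 1)) ↔ k ∈ Ico (a j) (a (j + 1))) :
    ∃ π : Equiv.Perm ℕ, ∀ j, ∀ k ∈ Ico (a j) (a (j + 1)), π k = σ j k := by
  have hex : ∀ k, ∃ j, k ∈ Ico (a j) (a (j + 1)) := by
    intro k
    have h : ∃ j, k < a (j + 1) := ⟨k, (Nat.lt_succ_self k).trans_le (ha.id_le _)⟩
    refine ⟨Nat.find h, ?_, Nat.find_spec h⟩
    rcases hj : Nat.find h with _ | j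
    · simp [ha0]
    · exact not_lt.1 (Nat.find_min h (m := j) (by omega))
  choose β hβ using hex
  have huniq : ∀ j k, k ∈ Ico (a j) (a (j + 1)) → β k = j := by
    intro j k hk
    have h1 := ha.lt_iff_lt.1 ((hβ k).1.trans_lt hk.2)
    have h2 := ha.lt_iff_lt.1 (hk.1.trans_lt (hβ k).2)
    omega
  have hsymm : ∀ j k, (σ j).symm k ∈ Ico (a j) (a (j + 1)) ↔ k ∈ Ico (a j) (a (j + 1)) := by
    intro j k
    rw [← hσ j, Equiv.apply_symm_apply]
  refine ⟨⟨fun k => σ (β k) k, fun k => (σ (β k)).symm k, fun k => ?_, fun k => ?_⟩,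
    fun j k hk => ?_⟩
  · simp only [huniq _ _ ((hσ (β k) k).2 (hβ k)), Equiv.symm_apply_apply]
  · simp only [huniq _ _ ((hsymm (β k) k).2 (hβ k)), Equiv.apply_symm_apply]
  · change σ (β k) k = σ j k
    rw [huniq j k hk]

/-! ### Finite sums, Baire category and a closed graph theorem -/

section Seminorms

variable {E : Type*} [AddCommGroup E] [Module ℝ E]

/-- If all rearrangements of a series converge, then its finite sums far out are small. -/
theorem exists_forall_finset_le_of_perm [TopologicalSpace E] [IsTopologicalAddGroup E]
    {v : ℕ → E} (hv : ∀ π : Equiv.Perm ℕ, ∃ s : E,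
      Tendsto (fun n => ∑ k ∈ Finset.range n, v (π k)) atTop (𝓝 s))
    {q : Seminorm ℝ E} (hq : Continuous q) {ε : ℝ} (hε : 0 < ε) :
    ∃ n, ∀ F : Finset ℕ, (∀ k ∈ F, n ≤ k) → q (∑ k ∈ F, v k) ≤ ε := by
  by_contra! hcon
  choose F hF hFε using hcon
  let b : ℕ → ℕ := fun n => max n ((F n).sup id) + 1
  have hFb : ∀ n, ∀ k ∈ F n, n ≤ k ∧ k < b n := fun n k hk =>
    ⟨hF n k hk, Nat.lt_succ_of_le (le_max_of_le_right (Finset.le_sup (f := id) hk))⟩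
  -- The block `[a j, a (j + 1))` contains `F (a j)`. Moving this set to the front of each block
  -- produces a rearrangement whose partial sums oscillate by more than `ε` in every block.
  let a : ℕ → ℕ := fun j => Nat.rec 0 (fun _ n => b n) j
  have ha : StrictMono a := strictMono_nat_of_lt_succ fun j =>
    Nat.lt_succ_of_le (le_max_left (a j) _)
  choose σ hσ hσF using fun n => exists_perm_Ico_map_eq n (b n) (F n) (hFb n)
  obtain ⟨π, hπ⟩ := exists_perm_eqOn_blocks ha rfl (fun j => σ (a j)) (fun j k => hσ (a j) k)
  obtain ⟨s, hs⟩ := hv π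
  have hlim : Tendsto (fun n => q ((∑ k ∈ Finset.range n, v (π k)) - s)) atTop (𝓝 0) := by
    simpa [Function.comp_def] using (hq.tendsto 0).comp (tendsto_sub_nhds_zero_iff.2 hs)
  obtain ⟨N, hN⟩ := eventually_atTop.1 (hlim.eventually (gt_mem_nhds (half_pos hε)))
  have hNa : N ≤ a N := ha.id_le N
  have hle : a N + (F (a N)).card ≤ a (N + 1) := by
    have := Finset.card_le_card
      (show F (a N) ⊆ Finset.Ico (a N) (b (a N)) from fun k hk => Finset.mem_Ico.2 (hFb _ k hk))
    rw [Nat.card_Ico] at this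
    have h2 : a N < a (N + 1) := ha (Nat.lt_succ_self N)
    change _ ≤ a (N + 1) - a N at this
    omega
  have hsum : ∑ k ∈ F (a N), v k =
      ((∑ k ∈ Finset.range (a N + (F (a N)).card), v (π k)) - s) -
        ((∑ k ∈ Finset.range (a N), v (π k)) - s) := by
    rw [sub_sub_sub_cancel_right, ← Finset.sum_Ico_eq_sub _ (Nat.le_add_right _ _),
      ← Finset.sum_congr (hσF (a N)) fun _ _ => rfl, Finset.sum_map]
    refine Finset.sum_congr rfl fun k hk => ?_
    rw [Finset.mem_Ico] at hk
    rw [hπ N k ⟨hk.1, hk.2.trans_le hle⟩]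
    rfl
  have h1 := hN _ hNa
  have h2 := hN _ (hNa.trans (Nat.le_add_right _ (F (a N)).card))
  have h3 := map_sub_le_add q ((∑ k ∈ Finset.range (a N + (F (a N)).card), v (π k)) - s)
    ((∑ k ∈ Finset.range (a N), v (π k)) - s)
  rw [← hsum] at h3
  linarith [hFε (a N)]

/-- Multipliers with values in `[0, 1]` do not increase the supremum of the finite subsums. -/
theorem seminorm_add_sum_smul_le (q : Seminorm ℝ E) (v : ℕ → E) (l : ℕ → ℝ) {C : ℝ} (F : Finset ℕ)
    (hl : ∀ k ∈ F, l k ∈ Icc (0 : ℝ) 1) (u : E)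
    (h : ∀ G ⊆ F, q (u + ∑ k ∈ G, v k) ≤ C) : q (u + ∑ k ∈ F, l k • v k) ≤ C := by
  classical
  induction F using Finset.induction_on generalizing u with
  | empty => simpa using h ∅ subset_rfl
  | insert a F ha ih =>
    have hl' : ∀ k ∈ F, l k ∈ Icc (0 : ℝ) 1 := fun k hk => hl k (Finset.mem_insert_of_mem hk)
    have h1 := ih hl' u fun G hG => h G (hG.trans (Finset.subset_insert _ _))
    have h2 := ih hl' (u + v a) fun G hG => by
      have := h (insert a G) (Finset.insert_subset_insert _ hG)
      rwa [Finset.sum_insert fun hh => ha (hG hh), ← add_assoc] at this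
    obtain ⟨h0, h1'⟩ := hl a (Finset.mem_insert_self _ _)
    -- The sum is affine in `l a`, hence a convex combination of the cases `l a = 0` and `l a = 1`;
    -- the shift `u` records the terms already chosen.
    have heq : u + ∑ k ∈ insert a F, l k • v k =
        (1 - l a) • (u + ∑ k ∈ F, l k • v k) + l a • (u + v a + ∑ k ∈ F, l k • v k) := by
      rw [Finset.sum_insert ha]
      module
    rw [heq]
    refine (map_add_le_add q _ _).trans ?_
    rw [map_smul_eq_mul, map_smul_eq_mul, Real.norm_of_nonneg h0,
      Real.norm_of_nonneg (sub_nonneg.2 h1')]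
    nlinarith

theorem seminorm_sum_smul_le (q : Seminorm ℝ E) (v : ℕ → E) (l : ℕ → ℝ) {C : ℝ} (F : Finset ℕ)
    (hl : ∀ k ∈ F, l k ∈ Icc (0 : ℝ) 1)
    (h : ∀ G ⊆ F, q (∑ k ∈ G, v k) ≤ C) : q (∑ k ∈ F, l k • v k) ≤ C := by
  simpa using seminorm_add_sum_smul_le q v l F hl 0 (by simpa using h)

/-- In a Baire space the closures of the balls of any seminorm are neighbourhoods of `0`. -/
theorem closure_closedBall_mem_nhds_zero [TopologicalSpace E] [IsTopologicalAddGroup E]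
    [ContinuousSMul ℝ E] [BaireSpace E] (q : Seminorm ℝ E) {r : ℝ} (hr : 0 < r) :
    closure (q.closedBall 0 r) ∈ 𝓝 (0 : E) := by
  have hU : ⋃ n : ℕ, closure (q.closedBall 0 (n + 1 : ℝ)) = univ := by
    refine eq_univ_of_forall fun x => ?_
    obtain ⟨n, hn⟩ := exists_nat_ge (q x)
    refine mem_iUnion.2 ⟨n, subset_closure ?_⟩
    rw [Seminorm.mem_closedBall_zero]
    linarith
  obtain ⟨n, x, hx⟩ := nonempty_interior_of_iUnion_of_closed (fun _ => isClosed_closure) hU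
  set B := q.closedBall 0 (n + 1 : ℝ)
  have hneg : -B = B := by
    ext y
    simp [B]
  have hx' : -x ∈ interior (closure B) := by
    have hc : -closure B = closure B := by
      conv_rhs => rw [← hneg]
      exact (Homeomorph.neg E).preimage_closure _
    have : -interior (closure B) = interior (closure B) := by
      conv_rhs => rw [← hc]
      exact (Homeomorph.neg E).preimage_interior _
    rw [← this]
    simpa using hx
  -- The closure of the ball is convex and symmetric, so `0`, the midpoint of `x` and `-x`, is
  -- interior.
  have hconv : Convex ℝ (interior (closure B)) := (q.convex_closedBall _ _).closure.interior
  have h0 : (0 : E) ∈ interior (closure B) := by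
    have := hconv hx hx' (show (0 : ℝ) ≤ 1 / 2 by norm_num) (show (0 : ℝ) ≤ 1 / 2 by norm_num)
      (by norm_num)
    simpa using this
  have hB : closure B ∈ 𝓝 (0 : E) := mem_interior_iff_mem_nhds.1 h0
  have hn : (0 : ℝ) < n + 1 := by positivity
  have hc : r / (n + 1) ≠ 0 := by positivity
  have := (set_smul_mem_nhds_zero_iff hc).2 hB
  rw [← closure_smul₀' hc] at this
  convert this using 2
  have := q.smul_closedBall_zero (k := r / (n + 1)) (r := n + 1) (norm_pos_iff.2 hc)
  rw [this, Real.norm_of_nonneg (by positivity), div_mul_cancel₀ _ hn.ne']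

/-- A closed graph theorem: an increasing sequence of seminorms on a first countable Baire space
is continuous as soon as its Cauchy sequences which converge in the space also converge, to the
same limit, with respect to the seminorms. -/
theorem continuous_of_cauchy_closed [TopologicalSpace E] [IsTopologicalAddGroup E]
    [ContinuousSMul ℝ E] [BaireSpace E] [FirstCountableTopology E] {Q : ℕ → Seminorm ℝ E}
    (hmono : Monotone Q)
    (hQ : ∀ (s : ℕ → E) (x : E), Tendsto s atTop (𝓝 x) →
      (∀ m, ∀ ε > 0, ∃ N, ∀ i ≥ N, ∀ j ≥ N, Q m (s i - s j) ≤ ε) →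
      ∀ m, Tendsto (fun j => Q m (x - s j)) atTop (𝓝 0)) (m : ℕ) : Continuous (Q m) := by
  obtain ⟨W, hW⟩ := (𝓝 (0 : E)).exists_antitone_basis
  -- Successive approximation: subtracting a point of `B j` from a point of `V j` can leave a
  -- remainder in `V (j + 1)`. The sets `W j` send the remainders to `0` in `E`. The index `m + j`
  -- makes the partial sums Cauchy for every `Q k`, and the radii sum to `2`.
  let B : ℕ → Set E := fun j => (Q (m + j)).closedBall 0 ((1 / 2) ^ j)
  let V : ℕ → Set E := fun j => closure (B j) ∩ W j
  have hV : ∀ j, V j ∈ 𝓝 (0 : E) := fun j =>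
    inter_mem (closure_closedBall_mem_nhds_zero _ (by positivity)) (hW.mem j)
  have step : ∀ j z, ∃ y, z ∈ V j → y ∈ B j ∧ z - y ∈ V (j + 1) := by
    intro j z
    by_cases hz : z ∈ V j
    · have hn : {y | z - y ∈ V (j + 1)} ∈ 𝓝 z := by
        have : Tendsto (fun y => z - y) (𝓝 z) (𝓝 0) := by
          simpa using (tendsto_const_nhds (x := z)).sub (tendsto_id (α := E) (x := 𝓝 z))
        exact this (hV (j + 1))
      obtain ⟨y, hy1, hy2⟩ := mem_closure_iff_nhds.1 hz.1 _ hn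
      exact ⟨y, fun _ => ⟨hy2, hy1⟩⟩
    · exact ⟨0, fun h => absurd h hz⟩
  choose Y hY using step
  have key : ∀ x ∈ V 0, Q m x ≤ 2 := by
    intro x hx
    let z : ℕ → E := fun j => Nat.rec x (fun j z => z - Y j z) j
    have hz : ∀ j, z j ∈ V j := by
      intro j
      induction j with
      | zero => exact hx
      | succ j ih => exact (hY j (z j) ih).2
    let y : ℕ → E := fun j => Y j (z j)
    have hy : ∀ j, y j ∈ B j := fun j => (hY j (z j) (hz j)).1
    have hzy : ∀ j, z (j + 1) = z j - y j := fun j => rfl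
    have hdiff : ∀ k i j, k ≤ m + i → Q k (z i - z (i + j)) ≤ 2 * (1 / 2) ^ i := by
      intro k i j hk
      have : Q k (z i - z (i + j)) ≤ 2 * (1 / 2) ^ i - 2 * (1 / 2) ^ (i + j) := by
        induction j with
        | zero => simp
        | succ j ih =>
          have h1 : z i - z (i + (j + 1)) = (z i - z (i + j)) + y (i + j) := by
            rw [← add_assoc, hzy]; abel
          have h2 : Q k (y (i + j)) ≤ (1 / 2) ^ (i + j) :=
            (hmono (show k ≤ m + (i + j) by omega) _).trans
              ((Q _).mem_closedBall_zero.1 (hy (i + j)))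
          have h3 := map_add_le_add (Q k) (z i - z (i + j)) (y (i + j))
          rw [h1]
          have : (1 / 2 : ℝ) ^ (i + (j + 1)) = (1 / 2) ^ (i + j) / 2 := by
            rw [← add_assoc, pow_succ]; ring
          linarith
      have h0 : (0 : ℝ) ≤ 2 * (1 / 2) ^ (i + j) := by positivity
      linarith
    have hz0 : Tendsto z atTop (𝓝 0) := hW.tendsto fun j => (hz j).2
    have hs : Tendsto (fun j => x - z j) atTop (𝓝 x) := by simpa using hz0.const_sub x
    have hc := hQ _ x hs (fun k ε hε => by
      have hlim : Tendsto (fun i : ℕ => 4 * (1 / 2 : ℝ) ^ i) atTop (𝓝 0) := by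
        simpa using (tendsto_pow_atTop_nhds_zero_of_lt_one (r := (1 / 2 : ℝ)) (by norm_num)
          (by norm_num)).const_mul 4
      obtain ⟨N, hN, hkN⟩ := ((hlim.eventually (ge_mem_nhds hε)).and (eventually_ge_atTop k)).exists
      refine ⟨N, fun i hi j hj => ?_⟩
      obtain ⟨i, rfl⟩ := Nat.exists_eq_add_of_le hi
      obtain ⟨j, rfl⟩ := Nat.exists_eq_add_of_le hj
      have h1 := hdiff k N i (by omega)
      have h2 := hdiff k N j (by omega)
      have h3 := map_sub_le_add (Q k) (z N - z (N + i)) (z N - z (N + j))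
      have h4 : x - z (N + i) - (x - z (N + j)) = z N - z (N + i) - (z N - z (N + j)) := by abel
      rw [h4]
      linarith) m
    refine ge_of_tendsto (x := atTop) (f := fun j => Q m (x - (x - z j)) + 2)
      (by simpa using hc.add_const 2) (Eventually.of_forall fun j => ?_)
    have h1 := hdiff m 0 j (by omega)
    have h2 := map_add_le_add (Q m) (x - (x - z j)) (x - z j)
    have h3 : x - (x - z j) + (x - z j) = x := by abel
    have h4 : z 0 = x := rfl
    rw [h3] at h2
    simp only [zero_add, h4, pow_zero, mul_one] at h1
    linarith
  refine Seminorm.continuous_of_continuousAt_zero (Seminorm.continuousAt_zero' (r := 2) ?_)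
  refine mem_of_superset (hV 0) fun x hx => ?_
  rw [Seminorm.mem_closedBall_zero]
  exact key x hx

end Seminorms

/-! ### Peano's theorem in a countable product -/

section Peano

variable {ι : Type*}

theorem continuous_of_abs_sub_le {M : ι → ℝ} {v : ℝ → ι → ℝ}
    (hv : ∀ s t k, |v s k - v t k| ≤ M k * |s - t|) : Continuous v := by
  refine continuous_pi fun k => ?_
  exact (LipschitzWith.of_dist_le' (K := M k) fun s t => by
    simpa [Real.dist_eq] using hv s t k).continuous

/-- Tonelli's approximation by an equation with delay. -/
theorem exists_delay_solution {F : ι → ℝ → (ι → ℝ) → ℝ}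
    (hF : ∀ k, Continuous fun q : ℝ × (ι → ℝ) => F k q.1 q.2) {M : ι → ℝ}
    (hM : ∀ k t y, |F k t y| ≤ M k) (y₀ : ι → ℝ) (T : ℝ) {δ : ℝ} (hδ : 0 < δ) :
    ∃ v : ℝ → ι → ℝ, (∀ s t k, |v s k - v t k| ≤ M k * |s - t|) ∧ v 0 = y₀ ∧
      ∀ k, ∀ t ∈ Icc 0 T, v t k = y₀ k + ∫ s in (0 : ℝ)..t, F k s (v (max (s - δ) 0)) := by
  let u : ℕ → ℝ → ι → ℝ := fun m => Nat.rec (fun _ => y₀)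
    (fun _ w t k => y₀ k + ∫ s in (0 : ℝ)..t, F k s (w (max (s - δ) 0))) m
  have hsucc : ∀ m t k, u (m + 1) t k =
      y₀ k + ∫ s in (0 : ℝ)..t, F k s (u m (max (s - δ) 0)) := fun m t k => rfl
  have hlip : ∀ m s t k, |u m s k - u m t k| ≤ M k * |s - t| := by
    intro m
    induction m with
    | zero =>
      intro s t k
      have : 0 ≤ M k := (abs_nonneg _).trans (hM k 0 y₀)
      simpa [u] using by positivity
    | succ m ih =>
      intro s t k
      have hc : Continuous fun r => F k r (u m (max (r - δ) 0)) :=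
        (hF k).comp (continuous_id.prodMk
          ((continuous_of_abs_sub_le ih).comp (by fun_prop)))
      rw [hsucc, hsucc, add_sub_add_left_eq_sub,
        intervalIntegral.integral_interval_sub_left (hc.intervalIntegrable _ _)
          (hc.intervalIntegrable _ _)]
      exact intervalIntegral.norm_integral_le_of_norm_le_const
        (f := fun r => F k r (u m (max (r - δ) 0))) fun r _ => hM k r _
  -- The delay makes the values on `[0, (m + 1) * δ]` depend only on those on `[0, m * δ]`, so the
  -- iteration becomes stationary and no fixed point theorem is needed.
  have hstab : ∀ m : ℕ, ∀ t ∈ Icc 0 (m * δ), u (m + 1) t = u m t := by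
    intro m
    induction m with
    | zero =>
      intro t ht
      obtain rfl : t = 0 := le_antisymm (by simpa using ht.2) ht.1
      ext k
      rw [hsucc, intervalIntegral.integral_same, add_zero]
      rfl
    | succ m ih =>
      intro t ht
      ext k
      rw [hsucc (m + 1), hsucc m]
      congr 1
      refine intervalIntegral.integral_congr fun s hs => ?_
      rw [uIcc_of_le ht.1] at hs
      have h2 := ht.2
      push_cast at h2
      have hm : (0 : ℝ) ≤ m * δ := by positivity
      change F k s _ = F k s _
      rw [ih _ ⟨le_max_right _ _, max_le (by linarith [hs.2]) hm⟩]
  obtain ⟨m, hm⟩ := exists_nat_ge (T / δ)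
  refine ⟨u m, hlip m, ?_, fun k t ht => ?_⟩
  · rcases m with _ | m
    · rfl
    · ext k
      rw [hsucc, intervalIntegral.integral_same, add_zero]
  · rw [← hstab m t ⟨ht.1, ht.2.trans ((div_le_iff₀ hδ).1 hm)⟩, hsucc]

/-- Pointwise selection for sequences of coordinatewise equi-Lipschitz curves. -/
theorem exists_subseq_tendsto_of_lipschitz [Countable ι] {M : ι → ℝ} {v : ℕ → ℝ → ι → ℝ}
    (hv : ∀ n s t k, |v n s k - v n t k| ≤ M k * |s - t|) {y₀ : ι → ℝ} (h0 : ∀ n, v n 0 = y₀) :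
    ∃ (φ : ℕ → ℕ) (y : ℝ → ι → ℝ), StrictMono φ ∧
      ∀ t k, Tendsto (fun n => v (φ n) t k) atTop (𝓝 (y t k)) := by
  -- Values at rational times lie in a countable product of compact intervals; the common Lipschitz
  -- bounds carry convergence over to all real times.
  let S : Set (ℚ × ι → ℝ) :=
    Set.pi univ fun a => Icc (y₀ a.2 - M a.2 * |(a.1 : ℝ)|) (y₀ a.2 + M a.2 * |(a.1 : ℝ)|)
  have hS : IsCompact S := isCompact_univ_pi fun _ => isCompact_Icc
  have hmem : ∀ n, (fun a : ℚ × ι => v n a.1 a.2) ∈ S := by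
    intro n a _
    have := hv n a.1 0 a.2
    rw [h0, sub_zero, abs_le] at this
    constructor <;> linarith
  obtain ⟨w, -, φ, hφ, hlim⟩ := hS.tendsto_subseq hmem
  have hconv : ∀ t k, ∃ l, Tendsto (fun n => v (φ n) t k) atTop (𝓝 l) := by
    intro t k
    refine cauchySeq_tendsto_of_complete (Metric.cauchySeq_iff.2 fun ε hε => ?_)
    have hM : 0 ≤ M k := by
      have := (abs_nonneg _).trans (hv 0 1 0 k)
      simpa using this
    obtain ⟨q, hq1, hq2⟩ := exists_rat_btwn (show t < t + ε / (3 * (M k + 1)) by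
      have : 0 < ε / (3 * (M k + 1)) := by positivity
      linarith)
    have hq : M k * |t - q| ≤ ε / 3 := by
      have h1 : |t - q| ≤ ε / (3 * (M k + 1)) := by
        rw [abs_le]; constructor <;> linarith
      calc M k * |t - q| ≤ (M k + 1) * (ε / (3 * (M k + 1))) := by gcongr; linarith
        _ = ε / 3 := by field_simp
    have hc := (tendsto_pi_nhds.1 hlim (q, k)).cauchySeq
    obtain ⟨N, hN⟩ := Metric.cauchySeq_iff.1 hc (ε / 3) (by positivity)
    refine ⟨N, fun i hi j hj => ?_⟩
    have h1 := hN i hi j hj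
    have h2 := (hv (φ i) t q k).trans hq
    have h3 := (hv (φ j) t q k).trans hq
    simp only [Function.comp_apply, Real.dist_eq] at h1 ⊢
    rw [abs_lt] at h1 ⊢
    rw [abs_le] at h2 h3
    constructor <;> linarith [h1.1, h1.2, h2.1, h2.2, h3.1, h3.2]
  choose y hy using hconv
  exact ⟨φ, y, hφ, hy⟩

/-- Peano's theorem for countable systems with bounded continuous right-hand sides. -/
theorem exists_integral_solution [Countable ι] {F : ι → ℝ → (ι → ℝ) → ℝ}
    (hF : ∀ k, Continuous fun q : ℝ × (ι → ℝ) => F k q.1 q.2) {M : ι → ℝ}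
    (hM : ∀ k t y, |F k t y| ≤ M k) (y₀ : ι → ℝ) (T : ℝ) :
    ∃ y : ℝ → ι → ℝ, Continuous y ∧
      ∀ k, ∀ t ∈ Icc 0 T, y t k = y₀ k + ∫ s in (0 : ℝ)..t, F k s (y s) := by
  have hδ : ∀ n : ℕ, (0 : ℝ) < 1 / (n + 1) := fun n => Nat.one_div_pos_of_nat
  choose v hlip h0 hv using fun n => exists_delay_solution hF hM y₀ T (hδ n)
  obtain ⟨φ, y, hφ, hy⟩ := exists_subseq_tendsto_of_lipschitz hlip h0
  have hylip : ∀ s t k, |y s k - y t k| ≤ M k * |s - t| := fun s t k =>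
    le_of_tendsto ((hy s k).sub (hy t k)).abs (Eventually.of_forall fun n => hlip (φ n) s t k)
  have hdelay : Tendsto (fun n => 1 / ((φ n : ℝ) + 1)) atTop (𝓝 0) :=
    tendsto_one_div_add_atTop_nhds_zero_nat.comp hφ.tendsto_atTop
  refine ⟨y, continuous_of_abs_sub_le hylip, fun k t ht => ?_⟩
  refine tendsto_nhds_unique (hy t k) ?_
  simp only [fun n => hv (φ n) k t ht]
  refine tendsto_const_nhds.add ?_
  refine intervalIntegral.tendsto_integral_filter_of_dominated_convergence (fun _ => M k)
    (Eventually.of_forall fun n => ?_) (Eventually.of_forall fun n => Eventually.of_forall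
      fun s _ => hM k s _) intervalIntegrable_const (Eventually.of_forall fun s hs => ?_)
  · exact ((hF k).comp (continuous_id.prodMk ((continuous_of_abs_sub_le (hlip (φ n))).comp
      (by fun_prop : Continuous fun s : ℝ => max (s - 1 / ((φ n : ℝ) + 1)) 0)))
      ).aestronglyMeasurable
  · rw [uIoc_of_le ht.1] at hs
    -- The Lipschitz constants do not depend on `n`, so the vanishing delay does not affect the
    -- limit.
    have hpt : Tendsto (fun n => v (φ n) (max (s - 1 / ((φ n : ℝ) + 1)) 0)) atTop (𝓝 (y s)) := by
      refine tendsto_pi_nhds.2 fun j => ?_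
      have hd : Tendsto (fun n => max (s - 1 / ((φ n : ℝ) + 1)) 0 - s) atTop (𝓝 0) := by
        have := ((hdelay.const_sub s).max (tendsto_const_nhds (x := (0 : ℝ)))).sub_const s
        simpa [max_eq_left hs.1.le] using this
      have h1 : Tendsto (fun n => v (φ n) (max (s - 1 / ((φ n : ℝ) + 1)) 0) j - v (φ n) s j)
          atTop (𝓝 0) := squeeze_zero_norm (fun n => hlip (φ n) _ s j)
            (by simpa using hd.abs.const_mul (M j))
      simpa using h1.add (hy s j)
    exact ((hF k).tendsto (s, y s)).comp (tendsto_const_nhds.prodMk_nhds hpt)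

end Peano

/-! ### Unconditional bases: the seminorms of finite subsums -/

section SchauderBasis

variable {E : Type*} [AddCommGroup E] [Module ℝ E] [TopologicalSpace E] [IsTopologicalAddGroup E]
  [ContinuousSMul ℝ E] {e : ℕ → E} (he : IsSchauderBasis e)

theorem coord_add (k : ℕ) (x y : E) : coord he k (x + y) = coord he k x + coord he k y := by
  refine coord_eq_of_tendsto he (c := fun k => coord he k x + coord he k y) ?_ k
  simpa [add_smul, Finset.sum_add_distrib] using (tendsto_coord he x).add (tendsto_coord he y)

theorem coord_smul (k : ℕ) (a : ℝ) (x : E) : coord he k (a • x) = a * coord he k x := by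
  refine coord_eq_of_tendsto he (c := fun k => a * coord he k x) ?_ k
  simpa [mul_smul, Finset.smul_sum] using (tendsto_coord he x).const_smul a

/-- The coordinates as linear forms. -/
noncomputable def coordLinear (k : ℕ) : E →ₗ[ℝ] ℝ where
  toFun := coord he k
  map_add' := coord_add he k
  map_smul' := coord_smul he k

/-- The projection to the span of finitely many basis vectors. -/
noncomputable def finProj (F : Finset ℕ) : E →ₗ[ℝ] E :=
  ∑ k ∈ F, (coordLinear he k).smulRight (e k)

theorem finProj_apply (F : Finset ℕ) (x : E) : finProj he F x = ∑ k ∈ F, coord he k x • e k := by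
  simp [finProj, coordLinear]

theorem tendsto_finProj_range (x : E) :
    Tendsto (fun n => finProj he (Finset.range n) x) atTop (𝓝 x) := by
  simpa only [finProj_apply] using tendsto_coord he x

theorem ext_coord [T2Space E] {x y : E} (h : ∀ k, coord he k x = coord he k y) : x = y := by
  have hx := tendsto_coord he x
  simp only [h] at hx
  exact tendsto_nhds_unique hx (tendsto_coord he y)

theorem IsSchauderBasis.ne_zero (he : IsSchauderBasis e) (k : ℕ) : e k ≠ 0 := by
  intro hk
  have h : coord he k (0 : E) = 1 := by
    refine (coord_eq_of_tendsto he (c := fun j => if j = k then 1 else 0) ?_ k).trans (if_pos rfl)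
    have : ∀ j, (if j = k then (1 : ℝ) else 0) • e j = 0 := by
      intro j
      by_cases hj : j = k
      · rw [hj, hk, smul_zero]
      · rw [if_neg hj, zero_smul]
    simpa [this] using tendsto_const_nhds
  rw [coord_zero] at h
  exact zero_ne_one h

variable {he}

theorem IsUnconditional.exists_forall_finProj_le (hu : IsUnconditional he)
    {q : Seminorm ℝ E} (hq : Continuous q) (x : E)
    {ε : ℝ} (hε : 0 < ε) :
    ∃ n, ∀ F : Finset ℕ, (∀ k ∈ F, n ≤ k) → q (finProj he F x) ≤ ε := by
  simp only [finProj_apply]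
  exact exists_forall_finset_le_of_perm (hu x) hq hε

theorem IsUnconditional.bddAbove_finProj (hu : IsUnconditional he)
    {q : Seminorm ℝ E} (hq : Continuous q) :
    BddAbove (range fun F : Finset ℕ => q.comp (finProj he F)) := by
  refine Seminorm.bddAbove_range_iff.2 fun x => ?_
  obtain ⟨n, hn⟩ := hu.exists_forall_finProj_le hq x one_pos
  refine ⟨∑ k ∈ Finset.range n, q (coord he k x • e k) + 1, ?_⟩
  rintro _ ⟨F, rfl⟩
  have h1 : q (∑ k ∈ F with k < n, coord he k x • e k) ≤
      ∑ k ∈ Finset.range n, q (coord he k x • e k) :=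
    (Finset.le_sum_of_subadditive q (map_zero q).le (map_add_le_add q) _ _).trans
      (Finset.sum_le_sum_of_subset_of_nonneg (fun k hk => by simp_all) fun _ _ _ => apply_nonneg _ _)
  have h2 := hn (F.filter fun k => ¬ k < n) fun k hk => not_lt.1 (Finset.mem_filter.1 hk).2
  have h3 := map_add_le_add q (∑ k ∈ F with k < n, coord he k x • e k)
    (∑ k ∈ F with ¬ k < n, coord he k x • e k)
  rw [Finset.sum_filter_add_sum_filter_not] at h3
  rw [finProj_apply] at h2
  simp only [Seminorm.comp_apply, finProj_apply]
  linarith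

/-- The supremum of a seminorm over all finite subsums of the expansion of a vector. -/
noncomputable def supSeminorm (he : IsSchauderBasis e) (q : Seminorm ℝ E) : Seminorm ℝ E :=
  ⨆ F : Finset ℕ, q.comp (finProj he F)

theorem IsUnconditional.supSeminorm_apply (hu : IsUnconditional he)
    {q : Seminorm ℝ E} (hq : Continuous q) (x : E) :
    supSeminorm he q x = ⨆ F : Finset ℕ, q (finProj he F x) :=
  Seminorm.iSup_apply (hu.bddAbove_finProj hq)

theorem IsUnconditional.le_supSeminorm (hu : IsUnconditional he)
    {q : Seminorm ℝ E} (hq : Continuous q) (F : Finset ℕ)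
    (x : E) : q (finProj he F x) ≤ supSeminorm he q x := by
  rw [hu.supSeminorm_apply hq]
  exact le_ciSup (Seminorm.bddAbove_range_iff.1 (hu.bddAbove_finProj hq) x) F

theorem IsUnconditional.supSeminorm_le (hu : IsUnconditional he)
    {q : Seminorm ℝ E} (hq : Continuous q) {x : E} {C : ℝ}
    (h : ∀ F, q (finProj he F x) ≤ C) : supSeminorm he q x ≤ C := by
  rw [hu.supSeminorm_apply hq]
  exact ciSup_le h

theorem IsUnconditional.abs_coord_mul_le (hu : IsUnconditional he)
    {q : Seminorm ℝ E} (hq : Continuous q) (k : ℕ) (x : E) :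
    |coord he k x| * q (e k) ≤ supSeminorm he q x := by
  have := hu.le_supSeminorm hq {k} x
  rwa [finProj_apply, Finset.sum_singleton, map_smul_eq_mul, Real.norm_eq_abs] at this

/-- Sequences which converge and are Cauchy with respect to all seminorms `supSeminorm` of a
family `q` finer than `p` converge with respect to these seminorms. -/
theorem IsUnconditional.tendsto_supSeminorm (hu : IsUnconditional he)
    {p : SeminormFamily ℝ E ℕ} (hp : WithSeminorms p) [T2Space E] {q : ℕ → Seminorm ℝ E}
    (hq : ∀ m, Continuous (q m)) (hpq : ∀ m, p m ≤ q m) {s : ℕ → E} {x : E}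
    (hs : Tendsto s atTop (𝓝 x))
    (hc : ∀ m, ∀ ε > 0, ∃ N, ∀ i ≥ N, ∀ j ≥ N, supSeminorm he (q m) (s i - s j) ≤ ε) (m : ℕ) :
    Tendsto (fun j => supSeminorm he (q m) (x - s j)) atTop (𝓝 0) := by
  have hlim : ∀ k, ∃ c, Tendsto (fun j => coord he k (s j)) atTop (𝓝 c) := by
    intro k
    obtain ⟨i, hi⟩ := hp.separating_of_T1 (e k) (he.ne_zero k)
    have hi' : 0 < q i (e k) :=
      ((apply_nonneg (p i) _).lt_of_ne (Ne.symm hi)).trans_le (hpq i _)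
    refine cauchySeq_tendsto_of_complete (Metric.cauchySeq_iff.2 fun ε hε => ?_)
    obtain ⟨N, hN⟩ := hc i (ε / 2 * q i (e k)) (by positivity)
    refine ⟨N, fun a ha b hb => ?_⟩
    have h := (hu.abs_coord_mul_le (hq i) k (s a - s b)).trans (hN a ha b hb)
    have h2 : coord he k (s a - s b) = coord he k (s a) - coord he k (s b) :=
      map_sub (coordLinear he k) _ _
    rw [h2] at h
    rw [Real.dist_eq]
    linarith [le_of_mul_le_mul_right h hi']
  choose c hcl using hlim
  have hF : ∀ F : Finset ℕ, Tendsto (fun i => finProj he F (s i)) atTop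
      (𝓝 (∑ k ∈ F, c k • e k)) := by
    intro F
    simp only [finProj_apply]
    exact tendsto_finsetSum _ fun k _ => (hcl k).smul_const _
  have hbound : ∀ m ε N, (∀ i ≥ N, ∀ j ≥ N, supSeminorm he (q m) (s i - s j) ≤ ε) →
      ∀ j ≥ N, ∀ F : Finset ℕ, q m (∑ k ∈ F, c k • e k - finProj he F (s j)) ≤ ε := by
    intro m ε N hN j hj F
    refine le_of_tendsto (((hq m).tendsto _).comp ((hF F).sub_const _)) ?_
    filter_upwards [eventually_ge_atTop N] with i hi
    rw [Function.comp_apply, ← map_sub]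
    exact (hu.le_supSeminorm (hq m) F _).trans (hN i hi j hj)
  -- Continuity of the coordinates is not yet known. Instead, the limits `c` are shown to expand
  -- `x`, and uniqueness of the expansion identifies them with its coordinates.
  have hsum : Tendsto (fun n => ∑ k ∈ Finset.range n, c k • e k) atTop (𝓝 x) := by
    refine (hp.tendsto_nhds _ _).2 fun i ε hε => ?_
    obtain ⟨N, hN⟩ := hc i (ε / 4) (by positivity)
    have h1 : Tendsto (fun j => q i (s j - x)) atTop (𝓝 0) := by
      simpa [Function.comp_def] using
        ((hq i).tendsto 0).comp (tendsto_sub_nhds_zero_iff.2 hs)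
    obtain ⟨j, hj, hjN⟩ := ((h1.eventually (gt_mem_nhds (show 0 < ε / 4 by positivity))).and
      (eventually_ge_atTop N)).exists
    have h2 : Tendsto (fun n => q i (finProj he (Finset.range n) (s j) - s j)) atTop (𝓝 0) := by
      simpa [Function.comp_def] using
        ((hq i).tendsto 0).comp (tendsto_sub_nhds_zero_iff.2 (tendsto_finProj_range he (s j)))
    filter_upwards [h2.eventually (gt_mem_nhds (show 0 < ε / 4 by positivity))] with n hn
    have h3 := hbound i _ N hN j hjN (Finset.range n)
    refine (hpq i _).trans_lt ?_
    have h4 : ∑ k ∈ Finset.range n, c k • e k - x =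
        (∑ k ∈ Finset.range n, c k • e k - finProj he (Finset.range n) (s j)) +
          ((finProj he (Finset.range n) (s j) - s j) + (s j - x)) := by abel
    rw [h4]
    have h5 := map_add_le_add (q i)
      (∑ k ∈ Finset.range n, c k • e k - finProj he (Finset.range n) (s j))
      ((finProj he (Finset.range n) (s j) - s j) + (s j - x))
    have h6 := map_add_le_add (q i) (finProj he (Finset.range n) (s j) - s j) (s j - x)
    linarith
  have hcx : ∀ F : Finset ℕ, finProj he F x = ∑ k ∈ F, c k • e k := fun F => by
    rw [finProj_apply]
    exact Finset.sum_congr rfl fun k _ => by rw [coord_eq_of_tendsto he hsum]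
  refine (Metric.tendsto_atTop).2 fun ε hε => ?_
  obtain ⟨N, hN⟩ := hc m (ε / 2) (by positivity)
  refine ⟨N, fun j hj => ?_⟩
  have : supSeminorm he (q m) (x - s j) ≤ ε / 2 := hu.supSeminorm_le (hq m) fun F => by
    rw [map_sub, hcx]
    exact hbound m _ N hN j hj F
  rw [Real.dist_eq, sub_zero, abs_of_nonneg (apply_nonneg _ _)]
  linarith

/-- `continuous_of_cauchy_closed` needs an increasing sequence of seminorms that controls the
topology, hence the enlargement of `q` to the `r m`, which dominate both `p m` and `q`. -/
theorem IsUnconditional.continuous_supSeminorm (hu : IsUnconditional he)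
    {p : SeminormFamily ℝ E ℕ} (hp : WithSeminorms p) [T2Space E] [BaireSpace E] {q : Seminorm ℝ E}
    (hq : Continuous q) : Continuous (supSeminorm he q) := by
  have := hp.firstCountableTopology
  let r : ℕ → Seminorm ℝ E := fun m => (Finset.Iic m).sup p ⊔ q
  have hr : ∀ m, Continuous (r m) := fun m =>
    (hp.partial_sups.continuous_seminorm m).sup hq
  have hpr : ∀ m, p m ≤ r m := fun m =>
    (Finset.le_sup (f := p) (Finset.mem_Iic.2 le_rfl)).trans le_sup_left
  have hrmono : Monotone r := fun a b hab =>
    sup_le_sup_right (Finset.sup_mono (Finset.Iic_subset_Iic.2 hab)) q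
  have hmono : Monotone fun m => supSeminorm he (r m) := fun a b hab x =>
    hu.supSeminorm_le (hr a) fun F => (hrmono hab _).trans (hu.le_supSeminorm (hr b) F x)
  refine Seminorm.continuous_of_le (continuous_of_cauchy_closed hmono
    (fun s x hs hc m => hu.tendsto_supSeminorm hp hr hpr hs hc m) 0) fun x => ?_
  exact hu.supSeminorm_le hq fun F =>
    ((le_sup_right : q ≤ r 0) _).trans (hu.le_supSeminorm (hr 0) F x)

theorem IsUnconditional.continuous_coord (hu : IsUnconditional he)
    {p : SeminormFamily ℝ E ℕ} (hp : WithSeminorms p) [T2Space E] [BaireSpace E] (k : ℕ) :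
    Continuous (coord he k) := by
  obtain ⟨i, hi⟩ := hp.separating_of_T1 (e k) (he.ne_zero k)
  have hi' : 0 < p i (e k) := (apply_nonneg (p i) _).lt_of_ne (Ne.symm hi)
  have hc := hp.continuous_seminorm i
  refine continuous_of_continuousAt_zero (coordLinear he k) ?_
  rw [ContinuousAt, map_zero]
  refine squeeze_zero_norm (a := fun x => supSeminorm he (p i) x / p i (e k)) (fun x => ?_) ?_
  · rw [le_div_iff₀ hi']
    exact hu.abs_coord_mul_le hc k x
  · have := ((hu.continuous_supSeminorm hp hc).tendsto 0).div_const (p i (e k))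
    simpa using this

/-- The expansions converge unconditionally, uniformly on compact sets. -/
theorem IsUnconditional.exists_forall_mem_compact_finProj_le (hu : IsUnconditional he)
    {p : SeminormFamily ℝ E ℕ} (hp : WithSeminorms p) [T2Space E] [BaireSpace E]
    {K : Set E} (hK : IsCompact K) {q : Seminorm ℝ E} (hq : Continuous q) {ε : ℝ} (hε : 0 < ε) :
    ∃ n, ∀ x ∈ K, ∀ F : Finset ℕ, (∀ k ∈ F, n ≤ k) → q (finProj he F x) ≤ ε := by
  refine hK.induction_on (p := fun S => ∃ n, ∀ x ∈ S, ∀ F : Finset ℕ, (∀ k ∈ F, n ≤ k) →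
    q (finProj he F x) ≤ ε) ⟨0, by simp⟩ ?_ ?_ ?_
  · rintro s t hst ⟨n, hn⟩
    exact ⟨n, fun x hx => hn x (hst hx)⟩
  · rintro s t ⟨n, hn⟩ ⟨m, hm⟩
    refine ⟨max n m, fun x hx F hF => ?_⟩
    rcases hx with hx | hx
    · exact hn x hx F fun k hk => (le_max_left _ _).trans (hF k hk)
    · exact hm x hx F fun k hk => (le_max_right _ _).trans (hF k hk)
  · intro x _
    obtain ⟨n, hn⟩ := hu.exists_forall_finProj_le hq x (half_pos hε)
    -- The tail estimate at `x` passes to nearby points because `supSeminorm` bounds all finite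
    -- projections of `y - x` at once.
    have hcont : Tendsto (fun y => supSeminorm he q (y - x)) (𝓝 x) (𝓝 0) := by
      simpa [Function.comp_def] using
        ((hu.continuous_supSeminorm hp hq).comp (continuous_sub_right x)).tendsto x
    refine ⟨_, mem_nhdsWithin_of_mem_nhds (hcont.eventually (gt_mem_nhds (half_pos hε))), n,
      fun y hy F hF => ?_⟩
    have h1 := hu.le_supSeminorm hq F (y - x)
    have h2 := map_add_le_add q (finProj he F (y - x)) (finProj he F x)
    rw [← map_add, sub_add_cancel] at h2
    have h3 : supSeminorm he q (y - x) < ε / 2 := hy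
    linarith [hn F hF]

end SchauderBasis

/-! ### Vectors built from dominated coordinates -/

section Synthesis

variable {E : Type*} [AddCommGroup E] [Module ℝ E] [UniformSpace E] [IsUniformAddGroup E]
  [CompleteSpace E] [T2Space E] [ContinuousSMul ℝ E] {e : ℕ → E} {he : IsSchauderBasis e}

/-- The quotients `c k / coord he k x` are multipliers in `[0, 1]`; where the denominator vanishes
so does `c k`, and division by zero gives the harmless value `0`. -/
theorem seminorm_sum_le_of_mem_Icc {x : E} {c : ℕ → ℝ} (hc : ∀ k, c k ∈ Icc 0 (coord he k x))
    (q : Seminorm ℝ E) {C : ℝ} (F : Finset ℕ) (h : ∀ G ⊆ F, q (finProj he G x) ≤ C) :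
    q (∑ k ∈ F, c k • e k) ≤ C := by
  have heq : ∀ k, c k • e k = (c k / coord he k x) • (coord he k x • e k) := by
    intro k
    rw [smul_smul]
    rcases eq_or_ne (coord he k x) 0 with h0 | h0
    · have := (hc k).2
      rw [h0] at this
      rw [h0, mul_zero, le_antisymm this (hc k).1]
    · rw [div_mul_cancel₀ _ h0]
  simp only [heq]
  refine seminorm_sum_smul_le q _ _ F (fun k _ => ?_) fun G hG => ?_
  · have h0 := (hc k).1.trans (hc k).2
    exact ⟨div_nonneg (hc k).1 h0, div_le_one_of_le₀ (hc k).2 h0⟩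
  · rw [← finProj_apply]
    exact h G hG

theorem IsUnconditional.summable_of_mem_Icc (hu : IsUnconditional he)
    {p : SeminormFamily ℝ E ℕ} (hp : WithSeminorms p) {x : E} {c : ℕ → ℝ}
    (hc : ∀ k, c k ∈ Icc 0 (coord he k x)) : Summable fun k => c k • e k := by
  refine summable_iff_vanishing.2 fun U hU => ?_
  obtain ⟨s, r, hr, hs⟩ := (hp.mem_nhds_iff 0 U).1 hU
  have hq : Continuous (s.sup p : Seminorm ℝ E) :=
    Seminorm.continuous_finsetSup fun i _ => hp.continuous_seminorm i
  obtain ⟨n, hn⟩ := hu.exists_forall_finProj_le hq x (half_pos hr)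
  refine ⟨Finset.range n, fun t ht => hs ?_⟩
  rw [Seminorm.mem_ball_zero]
  refine lt_of_le_of_lt ?_ (half_lt_self hr)
  refine seminorm_sum_le_of_mem_Icc hc _ t fun G hG => hn G fun k hk => ?_
  have := Finset.disjoint_left.1 ht (hG hk)
  simpa using this

theorem IsUnconditional.coord_tsum (hu : IsUnconditional he)
    {p : SeminormFamily ℝ E ℕ} (hp : WithSeminorms p) {x : E} {c : ℕ → ℝ}
    (hc : ∀ k, c k ∈ Icc 0 (coord he k x)) (k : ℕ) : coord he k (∑' j, c j • e j) = c k :=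
  coord_eq_of_tendsto he (hu.summable_of_mem_Icc hp hc).hasSum.tendsto_sum_nat k

/-- Finite heads are continuous, and the tails are dominated by tails of expansions of points of
`K`, which are uniformly small. -/
theorem IsUnconditional.continuous_tsum (hu : IsUnconditional he)
    {p : SeminormFamily ℝ E ℕ} (hp : WithSeminorms p) [BaireSpace E] {A : Type*} [TopologicalSpace A]
    {x : A → E} {c : A → ℕ → ℝ} {K : Set E} (hK : IsCompact K) (hx : ∀ a, x a ∈ K)
    (hcont : ∀ k, Continuous fun a => c a k) (hc : ∀ a k, c a k ∈ Icc 0 (coord he k (x a))) :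
    Continuous fun a => ∑' k, c a k • e k := by
  refine continuous_iff_continuousAt.2 fun a₀ => (hp.tendsto_nhds _ _).2 fun i ε hε => ?_
  have hq := hp.continuous_seminorm i
  obtain ⟨n, hn⟩ := hu.exists_forall_mem_compact_finProj_le hp hK hq
    (show 0 < ε / 4 by positivity)
  have htail : ∀ a, p i (∑' k, c a k • e k - ∑ k ∈ Finset.range n, c a k • e k) ≤ ε / 4 := by
    intro a
    refine le_of_tendsto ((hq.tendsto _).comp
      ((hu.summable_of_mem_Icc hp (hc a)).hasSum.tendsto_sum_nat.sub_const _)) ?_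
    filter_upwards [eventually_ge_atTop n] with m hm
    rw [Function.comp_apply, ← Finset.sum_Ico_eq_sub _ hm]
    refine seminorm_sum_le_of_mem_Icc (hc a) _ _ fun G hG => hn _ (hx a) G fun k hk => ?_
    exact (Finset.mem_Ico.1 (hG hk)).1
  have hfin : Continuous fun a => ∑ k ∈ Finset.range n, c a k • e k :=
    continuous_finsetSum _ fun k _ => (hcont k).smul continuous_const
  have hev := (hp.tendsto_nhds _ _).1 (hfin.tendsto a₀) i (ε / 4) (by positivity)
  filter_upwards [hev] with a ha
  have heq : ∑' k, c a k • e k - ∑' k, c a₀ k • e k =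
      (∑' k, c a k • e k - ∑ k ∈ Finset.range n, c a k • e k) +
        ((∑ k ∈ Finset.range n, c a k • e k - ∑ k ∈ Finset.range n, c a₀ k • e k) -
          (∑' k, c a₀ k • e k - ∑ k ∈ Finset.range n, c a₀ k • e k)) := by abel
  rw [heq]
  refine (map_add_le_add _ _ _).trans_lt ?_
  have h1 := map_sub_le_add (p i)
    (∑ k ∈ Finset.range n, c a k • e k - ∑ k ∈ Finset.range n, c a₀ k • e k)
    (∑' k, c a₀ k • e k - ∑ k ∈ Finset.range n, c a₀ k • e k)
  linarith [htail a, htail a₀]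

end Synthesis

/-! ### From coordinatewise to seminorm derivatives -/

section Derivative

/-- A seminorm attains its value at a given vector on a dominated linear form. -/
theorem exists_linear_eq_seminorm {E : Type*} [AddCommGroup E] [Module ℝ E] (q : Seminorm ℝ E)
    (w : E) : ∃ g : E →ₗ[ℝ] ℝ, g w = q w ∧ ∀ x, |g x| ≤ q x := by
  rcases eq_or_ne w 0 with rfl | hw
  · exact ⟨0, by simp, fun x => by simp⟩
  obtain ⟨g, hg, hgq⟩ := exists_extension_of_le_sublinear
    (LinearPMap.mkSpanSingleton (σ := RingHom.id ℝ) w (q w) hw) q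
    (fun c hc x => by rw [map_smul_eq_mul, Real.norm_of_nonneg hc.le]) (map_add_le_add q) (by
      rintro ⟨x, hx⟩
      obtain ⟨c, rfl⟩ := Submodule.mem_span_singleton.1 hx
      rw [LinearPMap.mkSpanSingleton'_apply]
      simp only [RingHom.id_apply, smul_eq_mul, map_smul_eq_mul]
      exact mul_le_mul_of_nonneg_right (le_abs_self c) (apply_nonneg q w))
  refine ⟨g, ?_, fun x => abs_le.2 ⟨?_, hgq x⟩⟩
  · exact (hg ⟨w, Submodule.mem_span_singleton_self w⟩).trans
      (LinearPMap.mkSpanSingleton'_apply_self _ _ _ _)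
  · have := hgq (-x)
    rw [map_neg, map_neg_eq_map] at this
    linarith

variable {E : Type*} [AddCommGroup E] [Module ℝ E] [TopologicalSpace E] [IsTopologicalAddGroup E]
  [ContinuousSMul ℝ E] {e : ℕ → E} {he : IsSchauderBasis e}

/-- Mean value inequality for curves that are differentiable in each coordinate. -/
theorem IsUnconditional.seminorm_sub_sub_smul_le (hu : IsUnconditional he)
    {q : Seminorm ℝ E}
    (hq : Continuous q) {x x' : ℝ → E} {S : Set ℝ} (hS : Convex ℝ S)
    (hx : ∀ k, ∀ t ∈ S, HasDerivWithinAt (fun s => coord he k (x s)) (coord he k (x' t)) S t)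
    (v : E) {C : ℝ} (hC : ∀ t ∈ S, supSeminorm he q (x' t - v) ≤ C) {s t : ℝ} (hs : s ∈ S)
    (ht : t ∈ S) : q (x s - x t - (s - t) • v) ≤ C * |s - t| := by
  refine le_of_tendsto ((hq.tendsto _).comp (tendsto_finProj_range he _))
    (Eventually.of_forall fun n => ?_)
  set F := Finset.range n
  -- Composing with a norming functional of the finite projection reduces the claim to the scalar
  -- mean value inequality, with a bound independent of `F`.
  obtain ⟨g, hg, hgq⟩ := exists_linear_eq_seminorm q (finProj he F (x s - x t - (s - t) • v))
  have hgF : ∀ z, g (finProj he F z) = ∑ k ∈ F, coord he k z * g (e k) := fun z => by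
    simp [finProj_apply]
  have hd : ∀ r ∈ S, HasDerivWithinAt (fun r => g (finProj he F (x r)) - r * g (finProj he F v))
      (g (finProj he F (x' r - v))) S r := by
    intro r hr
    have h1 : HasDerivWithinAt (fun r => g (finProj he F (x r))) (g (finProj he F (x' r))) S r := by
      simp only [hgF]
      exact HasDerivWithinAt.fun_sum fun k _ => (hx k r hr).mul_const _
    have h2 := (hasDerivWithinAt_id r S).mul_const (g (finProj he F v))
    rw [map_sub, map_sub]
    simpa using h1.fun_sub h2
  have := hS.norm_image_sub_le_of_norm_hasDerivWithin_le hd (C := C) (fun r hr =>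
    (hgq _).trans ((hu.le_supSeminorm hq F _).trans (hC r hr))) ht hs
  rw [Function.comp_apply, ← hg]
  refine le_trans (le_of_eq ?_) ((le_abs_self _).trans this)
  simp only [map_sub, map_smul, smul_eq_mul]
  ring

/-- Since `supSeminorm he (p i)` is continuous, `x'` is close to `x' t` in it near `t`; the mean
value inequality then bounds the difference quotient. -/
theorem IsUnconditional.hasSeminormDerivAt [T2Space E] [BaireSpace E] (hu : IsUnconditional he)
    {p : SeminormFamily ℝ E ℕ} (hp : WithSeminorms p) {T : ℝ} {x x' : ℝ → E}
    (hx : ∀ k, ∀ t ∈ Icc 0 T,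
      HasDerivWithinAt (fun s => coord he k (x s)) (coord he k (x' t)) (Icc 0 T) t)
    (hx' : ContinuousOn x' (Icc 0 T)) {t : ℝ} (ht : t ∈ Icc 0 T) :
    HasSeminormDerivAt p T x (x' t) t := by
  intro i
  have hq := hp.continuous_seminorm i
  have hcont : Tendsto (fun s => supSeminorm he (p i) (x' s - x' t)) (𝓝[Icc 0 T] t) (𝓝 0) := by
    simpa [Function.comp_def] using
      ((hu.continuous_supSeminorm hp hq).tendsto 0).comp (tendsto_sub_nhds_zero_iff.2 (hx' t ht))
  refine Metric.tendsto_nhds.2 fun ε hε => ?_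
  obtain ⟨δ, hδ, hball⟩ := Metric.mem_nhdsWithin_iff.1
    (hcont.eventually (gt_mem_nhds (half_pos hε)))
  filter_upwards [self_mem_nhdsWithin, mem_nhdsWithin_of_mem_nhds (Metric.ball_mem_nhds 0 hδ)]
    with h hh hhδ
  have hS : Convex ℝ (Metric.ball t δ ∩ Icc 0 T) := (convex_ball t δ).inter (convex_Icc 0 T)
  have hle := hu.seminorm_sub_sub_smul_le hq hS (fun k r hr => (hx k r hr.2).mono inter_subset_right)
    (x' t) (C := ε / 2) (fun r hr => le_of_lt (hball hr)) (s := t + h) (t := t)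
    ⟨by simpa using hhδ, hh.2⟩ ⟨Metric.mem_ball_self hδ, ht⟩
  rw [add_sub_cancel_left] at hle
  have heq : h⁻¹ • (x (t + h) - x t) - x' t = h⁻¹ • (x (t + h) - x t - h • x' t) := by
    rw [smul_sub h⁻¹ (x (t + h) - x t), smul_smul, inv_mul_cancel₀ hh.1, one_smul]
  rw [Real.dist_eq, sub_zero, abs_of_nonneg (apply_nonneg _ _), heq, map_smul_eq_mul, norm_inv,
    Real.norm_eq_abs]
  have hpos : 0 < |h| := abs_pos.2 hh.1
  calc |h|⁻¹ * p i (x (t + h) - x t - h • x' t) ≤ |h|⁻¹ * (ε / 2 * |h|) := by gcongr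
    _ = ε / 2 := by field_simp
    _ < ε := half_lt_self hε

end Derivative

/-! ### Scalar comparison -/

/-- A function which starts nonpositive and does not increase where it is positive stays
nonpositive. -/
theorem nonpos_of_hasDerivWithinAt_nonpos {T : ℝ} {w w' : ℝ → ℝ} (hw : ContinuousOn w (Icc 0 T))
    (hw' : ∀ t ∈ Ico 0 T, HasDerivWithinAt w (w' t) (Ici t) t) (h0 : w 0 ≤ 0)
    (h : ∀ t ∈ Ico 0 T, 0 < w t → w' t ≤ 0) {t : ℝ} (ht : t ∈ Icc 0 T) : w t ≤ 0 := by
  -- The barrier `ε * (1 + s)` is positive with slope `ε`; where `w` touches it, `w` is positive, so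
  -- its slope is at most `0 < ε`.
  have key : ∀ ε > 0, w t ≤ ε * (1 + t) := by
    intro ε hε
    refine image_le_of_deriv_right_lt_deriv_boundary' (B := fun s => ε * (1 + s))
      (B' := fun _ => ε) hw hw' (by simpa using h0.trans hε.le) (by fun_prop) (fun s _ => ?_)
      (fun s hs heq => (h s hs ?_).trans_lt hε) ht
    · simpa using (((hasDerivAt_id s).const_add 1).const_mul ε).hasDerivWithinAt
    · rw [heq]
      have := hs.1
      positivity
  have h1 : 0 < 1 + t := by linarith [ht.1]
  refine le_of_forall_pos_le_add fun ε hε => ?_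
  have := key (ε / (1 + t)) (by positivity)
  rwa [div_mul_cancel₀ _ h1.ne', ← zero_add ε] at this

end CountableODE

/-! ### The truncated problem and its solution -/

theorem theorem2p3 {E : Type*} [AddCommGroup E] [Module ℝ E]
    -- `E` is a Fréchet space with the topology of the seminorms `p n`
    [UniformSpace E] [IsUniformAddGroup E] [T2Space E] [CompleteSpace E]
    (p : SeminormFamily ℝ E ℕ) (hp : WithSeminorms p)
    -- with an unconditional Schauder basis
    (e : ℕ → E) (he : CountableODE.IsSchauderBasis e) (hu : CountableODE.IsUnconditional he)
    (T : ℝ) (hT : 0 < T)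
    (X : ℝ → E) (hX : ContinuousOn X (Icc 0 T))
    (hX1 : ∀ k, ContDiffOn ℝ 1 (fun t => CountableODE.coord he k (X t)) (Icc 0 T))
    (hXpos : ∀ k, ∀ t ∈ Icc 0 T, 0 < CountableODE.coord he k (X t))
    (f : ℝ → E → E)
    (hf : ContinuousOn (fun q : ℝ × E => f q.1 q.2) (CountableODE.WPlus he T X))
    (hupper : ∀ t x, (t, x) ∈ CountableODE.WPlus he T X → ∀ k,
      CountableODE.coord he k (f t (CountableODE.replaceCoord he k (X t) x)) ≤
        derivWithin (fun s => CountableODE.coord he k (X s)) (Icc 0 T) t)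
    (hlower : ∀ t x, (t, x) ∈ CountableODE.WPlus he T X → ∀ k,
      0 ≤ CountableODE.coord he k (f t (CountableODE.replaceCoord he k 0 x)))
    (x₀ : E) (hx₀ : CountableODE.Prec he 0 x₀) (hx₀X : CountableODE.Prec he x₀ (X 0)) :
    ∃ x x' : ℝ → E,
      ContinuousOn x' (Icc 0 T) ∧
      (∀ t ∈ Icc 0 T, CountableODE.HasSeminormDerivAt p T x (x' t) t) ∧
      (∀ t ∈ Icc 0 T, CountableODE.Prec he 0 (x t) ∧ CountableODE.Prec he (x t) (X t)) ∧
      (∀ t ∈ Icc 0 T, x' t = f t (x t)) ∧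
      x 0 = x₀ := by
  open CountableODE in
  have := hp.continuousSMul
  have := hp.firstCountableTopology
  have : (uniformity E).IsCountablyGenerated := IsUniformAddGroup.uniformity_countably_generated
  have hbaire : BaireSpace E := inferInstance
  -- the clamped time, the clamped coordinates and the clamped vector
  let τ : ℝ → ℝ := fun t => projIcc 0 T hT.le t
  have hτ : Continuous τ := continuous_subtype_val.comp continuous_projIcc
  have hτmem : ∀ t, τ t ∈ Icc 0 T := fun t => (projIcc 0 T hT.le t).2
  have hτid : ∀ t ∈ Icc 0 T, τ t = t := fun t ht => by simp only [τ, projIcc_of_mem hT.le ht]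
  have hXτ : Continuous fun t => X (τ t) := hX.comp_continuous hτ hτmem
  let c : ℝ × (ℕ → ℝ) → ℕ → ℝ := fun q k => max 0 (min (q.2 k) (coord he k (X (τ q.1))))
  have hcmem : ∀ q k, c q k ∈ Icc 0 (coord he k (X (τ q.1))) := fun q k =>
    ⟨le_max_left _ _, max_le (hXpos k _ (hτmem _)).le (min_le_right _ _)⟩
  have hccont : ∀ k, Continuous fun q => c q k := by
    intro k
    have h1 : Continuous fun q : ℝ × (ℕ → ℝ) => coord he k (X (τ q.1)) :=
      (hu.continuous_coord hp k).comp (hXτ.comp continuous_fst)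
    have h2 : Continuous fun q : ℝ × (ℕ → ℝ) => q.2 k := (continuous_apply k).comp continuous_snd
    exact continuous_const.max (h2.min h1)
  have hcid : ∀ t ∈ Icc 0 T, ∀ y : ℕ → ℝ, ∀ k, y k ∈ Icc 0 (coord he k (X t)) →
      c (t, y) k = y k := by
    intro t ht y k hy
    simp only [c, hτid t ht, min_eq_left hy.2, max_eq_right hy.1]
  -- The series is dominated by `X (τ t)`, which stays in the compact set `X '' Icc 0 T`; this gives
  -- convergence and joint continuity.
  let R : ℝ × (ℕ → ℝ) → E := fun q => ∑' k, c q k • e k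
  have hRcont : Continuous R := hu.continuous_tsum hp (isCompact_Icc.image_of_continuousOn hX)
    (fun q => mem_image_of_mem X (hτmem q.1)) hccont hcmem
  have hRcoord : ∀ q k, coord he k (R q) = c q k := fun q => hu.coord_tsum hp (hcmem q)
  have hRW : ∀ q, (τ q.1, R q) ∈ WPlus he T X := by
    refine fun q => ⟨hτmem q.1, fun k => ?_, fun k => ?_⟩
    · rw [coord_zero, hRcoord]
      exact (hcmem q k).1
    · rw [hRcoord]
      exact (hcmem q k).2
  have hgcont : Continuous fun q : ℝ × (ℕ → ℝ) => f (τ q.1) (R q) :=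
    hf.comp_continuous ((hτ.comp continuous_fst).prodMk hRcont) hRW
  let F : ℕ → ℝ → (ℕ → ℝ) → ℝ := fun k t y => coord he k (f (τ t) (R (t, y)))
  have hF : ∀ k, Continuous fun q : ℝ × (ℕ → ℝ) => F k q.1 q.2 := fun k =>
    (hu.continuous_coord hp k).comp hgcont
  have hbdd : ∀ k, ∃ M, ∀ t y, |F k t y| ≤ M := by
    intro k
    have hB : ∀ j, ∃ B, ∀ t ∈ Icc 0 T, coord he j (X t) ≤ B := fun j => by
      obtain ⟨B, hB⟩ := (isCompact_Icc.image_of_continuousOn (hX1 j).continuousOn).bddAbove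
      exact ⟨B, fun t ht => hB (mem_image_of_mem _ ht)⟩
    choose B hB using hB
    have hK : IsCompact (Icc 0 T ×ˢ Set.pi univ fun j => Icc 0 (B j)) :=
      isCompact_Icc.prod (isCompact_univ_pi fun _ => isCompact_Icc)
    obtain ⟨M, hM⟩ := hK.exists_bound_of_continuousOn (hF k).continuousOn
    refine ⟨M, fun t y => ?_⟩
    have hmem : (τ t, c (t, y)) ∈ Icc 0 T ×ˢ Set.pi univ fun j => Icc 0 (B j) :=
      ⟨hτmem t, fun j _ => ⟨(hcmem (t, y) j).1, (hcmem (t, y) j).2.trans (hB j _ (hτmem t))⟩⟩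
    -- Clamping is idempotent, so every value of `F k` is attained on the compact box.
    have hR : R (τ t, c (t, y)) = R (t, y) := by
      simp only [R]
      exact tsum_congr fun j => by rw [hcid _ (hτmem t) _ j (hcmem (t, y) j)]
    have := hM _ hmem
    simpa only [F, hR, hτid _ (hτmem t), Real.norm_eq_abs] using this
  choose M hM using hbdd
  obtain ⟨y, hy, hint⟩ := exists_integral_solution hF hM (fun k => coord he k x₀) T
  have hGcont : ∀ k, Continuous fun s => F k s (y s) := fun k =>
    (hF k).comp (continuous_id.prodMk hy)
  have hderiv : ∀ k, ∀ t ∈ Icc 0 T,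
      HasDerivWithinAt (fun s => y s k) (F k t (y t)) (Icc 0 T) t := by
    intro k t ht
    have h1 := ((hGcont k).integral_hasStrictDerivAt 0 t).hasDerivAt.const_add (coord he k x₀)
    exact h1.hasDerivWithinAt.congr (fun s hs => hint k s hs) (hint k t ht)
  have hIci : ∀ t ∈ Ico 0 T, Icc 0 T ∈ 𝓝[Ici t] t := fun t ht =>
    mem_of_superset (Icc_mem_nhdsGE ht.2) (Icc_subset_Icc_left ht.1)
  have hy0 : ∀ k, y 0 k = coord he k x₀ := fun k => by
    simpa using hint k 0 ⟨le_rfl, hT.le⟩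
  have hzero : (0 : ℝ) ∈ Icc 0 T := ⟨le_rfl, hT.le⟩
  have hlow : ∀ k, ∀ t ∈ Icc 0 T, 0 ≤ y t k := by
    intro k t ht
    refine neg_nonpos.1 (nonpos_of_hasDerivWithinAt_nonpos (w := fun s => -y s k)
      (w' := fun s => -F k s (y s)) (fun s hs => (hderiv k s hs).neg.continuousWithinAt)
      (fun s hs => (hderiv k s (Ico_subset_Icc_self hs)).neg.mono_of_mem_nhdsWithin (hIci s hs))
      ?_ (fun s hs hpos => ?_) ht)
    · have := hx₀ k
      rw [coord_zero] at this
      simpa [hy0] using this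
    -- A negative coordinate is clamped to `0`, so `replaceCoord` with `0` leaves the point
    -- unchanged and `hlower` applies to it directly.
    · have hRk : coord he k (R (s, y s)) = 0 := by
        rw [hRcoord]
        exact max_eq_left ((min_le_left _ _).trans (neg_pos.1 hpos).le)
      have := hlower _ _ (hRW (s, y s)) k
      rw [replaceCoord, coord_zero, hRk, sub_zero, zero_smul, add_zero] at this
      exact neg_nonpos.2 this
  have hupp : ∀ k, ∀ t ∈ Icc 0 T, y t k ≤ coord he k (X t) := by
    intro k t ht
    have hXd : ∀ s ∈ Icc 0 T, HasDerivWithinAt (fun r => coord he k (X r))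
        (derivWithin (fun r => coord he k (X r)) (Icc 0 T) s) (Icc 0 T) s := fun s hs =>
      ((hX1 k).differentiableOn one_ne_zero s hs).hasDerivWithinAt
    refine sub_nonpos.1 (nonpos_of_hasDerivWithinAt_nonpos
      (w := fun s => y s k - coord he k (X s))
      (w' := fun s => F k s (y s) - derivWithin (fun r => coord he k (X r)) (Icc 0 T) s)
      (fun s hs => ((hderiv k s hs).fun_sub (hXd s hs)).continuousWithinAt)
      (fun s hs => ((hderiv k s (Ico_subset_Icc_self hs)).fun_sub
        (hXd s (Ico_subset_Icc_self hs))).mono_of_mem_nhdsWithin (hIci s hs))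
      ?_ (fun s hs hpos => ?_) ht)
    · simpa [hy0] using hx₀X k
    · have hs' := Ico_subset_Icc_self hs
      have hRk : coord he k (R (s, y s)) = coord he k (X (τ s)) := by
        rw [hRcoord]
        simp only [c]
        rw [min_eq_right (by rw [hτid s hs']; exact (sub_pos.1 hpos).le),
          max_eq_right (hXpos k _ (hτmem s)).le]
      have := hupper _ _ (hRW (s, y s)) k
      rw [replaceCoord, hRk, sub_self, zero_smul, add_zero, hτid s hs'] at this
      simpa only [F, hτid s hs', sub_nonpos] using this
  -- Both bounds hold, so the clamps are inactive and `R (t, y t)` has exactly the coordinates `y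
  -- t`.
  have hxcoord : ∀ t ∈ Icc 0 T, ∀ k, coord he k (R (t, y t)) = y t k := fun t ht k => by
    rw [hRcoord, hcid t ht _ k ⟨hlow k t ht, hupp k t ht⟩]
  have hx'cont : Continuous fun t => f (τ t) (R (t, y t)) :=
    hgcont.comp (continuous_id.prodMk hy)
  refine ⟨fun t => R (t, y t), fun t => f (τ t) (R (t, y t)), hx'cont.continuousOn,
    fun t ht => hu.hasSeminormDerivAt hp (fun k s hs => ?_) hx'cont.continuousOn ht,
    fun t ht => ⟨fun k => ?_, fun k => ?_⟩, fun t ht => ?_, ?_⟩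
  · exact (hderiv k s hs).congr (fun r hr => hxcoord r hr k) (hxcoord s hs k)
  · rw [coord_zero, hxcoord t ht]
    exact hlow k t ht
  · rw [hxcoord t ht]
    exact hupp k t ht
  · simp only [hτid t ht]
  · exact ext_coord he fun k => by rw [hxcoord 0 hzero, hy0]
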